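/- **Setting.** Consider first-order formulas over an arbitrary set of propositional symbols (arity $0$) and an arbitrary set of predicate symbols of positive arity, without equality, function symbols or object constants, built with $\top,\bot,\neg,\&,\vee,\supset,\forall,\exists$; there are infinitely many variables, and formulas may contain free variables. $\mathrm{LJ}^+$ is Gentzen's intuitionistic sequent calculus $\mathrm{LJ}$ (with cut, and with the axioms $\vdash\top$ and $\bot\vdash$) extended by the neutralization rule: from $N,\Gamma\vdash\Lambda$ and $\neg N,\Gamma\vdash\Lambda$ infer $\Gamma\vdash\Lambda$, where $N$ is any propositional formula, i.e. a formula containing no predicate symbols. A formula $F$ is derivable in $\mathrm{LJ}^+$ if the sequent $\vdash F$ is. An occurrence of a propositional symbol in a formula $F$ is positive (negative) in $F$ if it lies within an even (odd) number of negations and left-hand sides of implications. A formula is *unipolar* if, for every propositional symbol, its occurrences in the formula are all positive or all negative. The *existence property* holds for $\exists x\,F(x)$ if derivability of $\exists x\,F(x)$ in $\mathrm{LJ}^+$ implies that $F(t)$ is derivable in $\mathrm{LJ}^+$ for some variable $t$. **Theorem.** Let $A(x)$ be a unipolar formula and let $B$ be a formula in which $x$ does not occur free. The existence property holds for each of the following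 formulas. 1. $\exists x\,(A(x)\,\&\,B)$. 2. $\exists x\,(A(x)\vee B)$, provided that every propositional symbol occurring in both $A(x)$ and $B$ has only positive or only negative occurrences in $A(x)\vee B$. 3. $\exists x\,(B\supset A(x))$, provided that $B$ is propositional and that every propositional symbol occurring in both $A(x)$ and $B$ has only positive or only negative occurrences in $B\supset A(x)$. -/

import Mathlib

namespace LJP

universe u v

/-- An individual variable inside `n` quantifiers: a free variable, taken from a countably infinite
supply, or a bound variable, given by its de Bruijn index. There are no function symbols and no
object constants. -/
inductive Var (n : ℕ) : Type
  | free (a : ℕ) : Var n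
  | bound (i : Fin n) : Var n

/-- First-order formulas inside `n` quantifiers. `P` is the set of propositional symbols, and `R k`
is the set of predicate symbols of arity `k + 1`, so that predicate symbols have positive arity.
Formulas in the usual sense are those with `n = 0`; formulas `A(x)` with a distinguished variable
`x` that can be quantified or instantiated are those with `n = 1`. -/
inductive Formula (P : Type u) (R : ℕ → Type v) : ℕ → Type (max u v)
  | top {n : ℕ} : Formula P R n
  | bot {n : ℕ} : Formula P R n
  | prop {n : ℕ} (p : P) : Formula P R n
  | pred {n k : ℕ} (r : R k) (ts : Fin (k + 1) → Var n) : Formula P R n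
  | neg {n : ℕ} (A : Formula P R n) : Formula P R n
  | and {n : ℕ} (A B : Formula P R n) : Formula P R n
  | or {n : ℕ} (A B : Formula P R n) : Formula P R n
  | imp {n : ℕ} (A B : Formula P R n) : Formula P R n
  | all {n : ℕ} (A : Formula P R (n + 1)) : Formula P R n
  | ex {n : ℕ} (A : Formula P R (n + 1)) : Formula P R n

/-- Replace the bound variables of a variable according to `σ`. -/
def Var.subst {n m : ℕ} (σ : Fin n → Var m) : Var n → Var m
  | .free a => .free a
  | .bound i => σ i

/-- The replacement `σ` carried under one more quantifier: the new bound variable stays fixed. -/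
def Var.lift {n m : ℕ} (σ : Fin n → Var m) : Fin (n + 1) → Var (m + 1) :=
  Fin.cases (.bound 0) (fun i => (σ i).subst (fun j => .bound j.succ))

namespace Formula

variable {P : Type u} {R : ℕ → Type v}

/-- Simultaneous (capture-free) replacement of the `n` outer bound variables according to `σ`. -/
def subst : {n m : ℕ} → (Fin n → Var m) → Formula P R n → Formula P R m
  | _, _, _, .top => .top
  | _, _, _, .bot => .bot
  | _, _, _, .prop p => .prop p
  | _, _, σ, .pred r ts => .pred r (fun i => (ts i).subst σ)
  | _, _, σ, .neg A => .neg (A.subst σ)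
  | _, _, σ, .and A B => .and (A.subst σ) (B.subst σ)
  | _, _, σ, .or A B => .or (A.subst σ) (B.subst σ)
  | _, _, σ, .imp A B => .imp (A.subst σ) (B.subst σ)
  | _, _, σ, .all A => .all (A.subst (Var.lift σ))
  | _, _, σ, .ex A => .ex (A.subst (Var.lift σ))

/-- `A.inst a` is `A(a)`, where `A` is `A(x)` and `a` is a free variable. -/
def inst (A : Formula P R 1) (a : ℕ) : Formula P R 0 :=
  A.subst (fun _ => .free a)

/-- A formula `B`, regarded as a formula `B(x)` in which `x` does not occur. -/
def weaken (B : Formula P R 0) : Formula P R 1 :=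
  B.subst Fin.elim0

/-- The free variable `a` occurs in the formula. -/
def HasVar (a : ℕ) : {n : ℕ} → Formula P R n → Prop
  | _, .top => False
  | _, .bot => False
  | _, .prop _ => False
  | _, .pred _ ts => ∃ i, ts i = .free a
  | _, .neg A => A.HasVar a
  | _, .and A B => A.HasVar a ∨ B.HasVar a
  | _, .or A B => A.HasVar a ∨ B.HasVar a
  | _, .imp A B => A.HasVar a ∨ B.HasVar a
  | _, .all A => A.HasVar a
  | _, .ex A => A.HasVar a

/-- A formula is propositional if it contains no predicate symbols. -/
def IsPropositional : {n : ℕ} → Formula P R n → Prop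
  | _, .top => True
  | _, .bot => True
  | _, .prop _ => True
  | _, .pred _ _ => False
  | _, .neg A => A.IsPropositional
  | _, .and A B => A.IsPropositional ∧ B.IsPropositional
  | _, .or A B => A.IsPropositional ∧ B.IsPropositional
  | _, .imp A B => A.IsPropositional ∧ B.IsPropositional
  | _, .all A => A.IsPropositional
  | _, .ex A => A.IsPropositional

/-- `A.Occ p true` (`A.Occ p false`): the propositional symbol `p` has a positive (negative)
occurrence in `A`. Polarity is reversed by negation and on the left of an implication. -/
def Occ (p : P) : {n : ℕ} → Formula P R n → Bool → Prop
  | _, .top, _ => False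
  | _, .bot, _ => False
  | _, .prop q, s => q = p ∧ s = true
  | _, .pred _ _, _ => False
  | _, .neg A, s => A.Occ p (!s)
  | _, .and A B, s => A.Occ p s ∨ B.Occ p s
  | _, .or A B, s => A.Occ p s ∨ B.Occ p s
  | _, .imp A B, s => A.Occ p (!s) ∨ B.Occ p s
  | _, .all A, s => A.Occ p s
  | _, .ex A, s => A.Occ p s

/-- The propositional symbol `p` occurs in `A`. -/
def Contains {n : ℕ} (A : Formula P R n) (p : P) : Prop :=
  A.Occ p true ∨ A.Occ p false

/-- The occurrences of `p` in `A` are all positive or all negative. -/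
def UnipolarAt {n : ℕ} (A : Formula P R n) (p : P) : Prop :=
  ¬ A.Occ p false ∨ ¬ A.Occ p true

/-- The occurrences of every propositional symbol in `A` are all positive or all negative. -/
def Unipolar {n : ℕ} (A : Formula P R n) : Prop :=
  ∀ p : P, A.UnipolarAt p

end Formula

/-- Derivability of sequents `Γ ⊢ Λ` in LJ⁺: Gentzen's LJ (with cut, and with the constants `⊤`
and `⊥`) together with the neutralization rule. The antecedent is a finite sequence of formulas, and
the succedent is a formula or empty. -/
inductive LJPlus {P : Type u} {R : ℕ → Type v} :
    List (Formula P R 0) → Option (Formula P R 0) → Prop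
  | ax (A) : LJPlus [A] (some A)
  | top_ax : LJPlus [] (some .top)
  | bot_ax : LJPlus [.bot] none
  | thin_left {A Γ Λ} : LJPlus Γ Λ → LJPlus (A :: Γ) Λ
  | thin_right {A Γ} : LJPlus Γ none → LJPlus Γ (some A)
  | contraction {A Γ Λ} : LJPlus (A :: A :: Γ) Λ → LJPlus (A :: Γ) Λ
  | exchange {Δ A B Γ Λ} : LJPlus (Δ ++ A :: B :: Γ) Λ → LJPlus (Δ ++ B :: A :: Γ) Λ
  | cut {C Γ Δ Λ} : LJPlus Γ (some C) → LJPlus (C :: Δ) Λ → LJPlus (Γ ++ Δ) Λ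
  | and_right {A B Γ} : LJPlus Γ (some A) → LJPlus Γ (some B) → LJPlus Γ (some (.and A B))
  | and_left₁ {A B Γ Λ} : LJPlus (A :: Γ) Λ → LJPlus (.and A B :: Γ) Λ
  | and_left₂ {A B Γ Λ} : LJPlus (B :: Γ) Λ → LJPlus (.and A B :: Γ) Λ
  | or_left {A B Γ Λ} : LJPlus (A :: Γ) Λ → LJPlus (B :: Γ) Λ → LJPlus (.or A B :: Γ) Λ
  | or_right₁ {A B Γ} : LJPlus Γ (some A) → LJPlus Γ (some (.or A B))
  | or_right₂ {A B Γ} : LJPlus Γ (some B) → LJPlus Γ (some (.or A B))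
  | neg_right {A Γ} : LJPlus (A :: Γ) none → LJPlus Γ (some (.neg A))
  | neg_left {A Γ} : LJPlus Γ (some A) → LJPlus (.neg A :: Γ) none
  | imp_right {A B Γ} : LJPlus (A :: Γ) (some B) → LJPlus Γ (some (.imp A B))
  | imp_left {A B Γ Δ Λ} : LJPlus Γ (some A) → LJPlus (B :: Δ) Λ →
      LJPlus (.imp A B :: (Γ ++ Δ)) Λ
  | all_right {F : Formula P R 1} {Γ} (a : ℕ) (hF : ¬ F.HasVar a) (hΓ : ∀ G ∈ Γ, ¬ G.HasVar a) :
      LJPlus Γ (some (F.inst a)) → LJPlus Γ (some (.all F))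
  | all_left {F : Formula P R 1} {Γ Λ} (a : ℕ) : LJPlus (F.inst a :: Γ) Λ → LJPlus (.all F :: Γ) Λ
  | ex_right {F : Formula P R 1} {Γ} (a : ℕ) : LJPlus Γ (some (F.inst a)) → LJPlus Γ (some (.ex F))
  | ex_left {F : Formula P R 1} {Γ Λ} (a : ℕ) (hF : ¬ F.HasVar a) (hΓ : ∀ G ∈ Γ, ¬ G.HasVar a)
      (hΛ : ∀ G ∈ Λ, ¬ G.HasVar a) : LJPlus (F.inst a :: Γ) Λ → LJPlus (.ex F :: Γ) Λ
  | neutralization {N Γ Λ} (hN : N.IsPropositional) :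
      LJPlus (N :: Γ) Λ → LJPlus (.neg N :: Γ) Λ → LJPlus Γ Λ

/-- A formula is derivable in LJ⁺ if the sequent with empty antecedent and this succedent is. -/
def Derivable {P : Type u} {R : ℕ → Type v} (A : Formula P R 0) : Prop :=
  LJPlus [] (some A)

/-- The existence property of LJ⁺ for the formula `∃x F(x)`: if it is derivable, then `F(a)` is
derivable for some variable `a`. -/
def ExistenceProperty {P : Type u} {R : ℕ → Type v} (F : Formula P R 1) : Prop :=
  Derivable (.ex F) → ∃ a : ℕ, Derivable (F.inst a)

end LJP

/-! Fix a valuation `v` of the propositional symbols and replace every symbol by `⊤` or `⊥`.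
Derivations survive this replacement (`LJPlus.translate`), and every propositional formula becomes
decided: it or its negation is derivable. Hence Kleene's slash, read on the replaced formulas, is
sound even for neutralization (`LJPlus.slash`), so a derivable `∃x F(x)` has a witness for each `v`
(`exists_slash_of_derivable_ex`). The witness may depend on `v`.

To return to the original formulas, the literals true under `v` let a replaced formula entail the
original one, with only one kind of literal needed for each polarity (`translate_entails`), and
neutralization then discharges the finitely many literals (`derivable_subst_of_forall`). If `A` is
unipolar, making its positive symbols false and its negative ones true yields a replacement that
entails `A` with no literals at all. A single witness for this `strongest` valuation therefore
serves every valuation. The polarity conditions linking `A` and `B` ensure that when `B`, or `¬B`,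
has to be derived instead, these same valuations suffice. -/

namespace LJP

universe u v

/-! ### Syntax: substitution, replacement of symbols by truth values, fresh variables. -/

/-- Rename the free variables by `ρ` and replace the bound variables according to `e`. -/
def Var.translate {n m : ℕ} (ρ : ℕ → ℕ) (e : Fin n → Var m) : Var n → Var m
  | .free a => .free (ρ a)
  | .bound i => e i

/-- The value of a variable when free variables are evaluated by `ρ` and bound ones by `e`. -/
def Var.value {n : ℕ} (ρ : ℕ → ℕ) (e : Fin n → ℕ) : Var n → ℕ
  | .free a => ρ a
  | .bound i => e i

theorem Var.lift_subst_lift {n m k : ℕ} (e : Fin n → Var m) (σ : Fin m → Var k) :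
    (fun i => (Var.lift e i).subst (Var.lift σ)) = Var.lift (fun i => (e i).subst σ) := by
  funext i
  refine Fin.cases rfl (fun j => ?_) i
  simp only [Var.lift, Fin.cases_succ]
  cases e j <;> rfl

theorem Var.lift_translate_lift {n m k : ℕ} (ρ : ℕ → ℕ) (e : Fin m → Var k) (σ : Fin n → Var m) :
    (fun i => (Var.lift σ i).translate ρ (Var.lift e)) =
      Var.lift (fun i => (σ i).translate ρ e) := by
  funext i
  refine Fin.cases rfl (fun j => ?_) i
  simp only [Var.lift, Fin.cases_succ]
  cases σ j <;> rfl

theorem Var.lift_value_cons {n m : ℕ} (ρ : ℕ → ℕ) (e : Fin m → ℕ) (σ : Fin n → Var m) (a : ℕ) :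
    (fun i => (Var.lift σ i).value ρ (Fin.cons a e : Fin (m + 1) → ℕ)) =
      (Fin.cons a (fun i => (σ i).value ρ e) : Fin (n + 1) → ℕ) := by
  funext i
  refine Fin.cases rfl (fun j => ?_) i
  simp only [Var.lift, Fin.cases_succ, Fin.cons_succ]
  cases σ j <;> rfl

theorem Var.lift_subst_free {n : ℕ} (e : Fin n → Var 0) (a : ℕ) :
    (fun i => (Var.lift e i).subst (fun _ : Fin 1 => (Var.free a : Var 0))) =
      (Fin.cons (Var.free a) e : Fin (n + 1) → Var 0) := by
  funext i
  refine Fin.cases rfl (fun j => ?_) i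
  simp only [Var.lift, Fin.cases_succ, Fin.cons_succ]
  rcases e j with b | i
  · rfl
  · exact i.elim0

theorem Var.free_comp_cons {n : ℕ} (e : Fin n → ℕ) (a : ℕ) :
    (fun i => (Var.free ((Fin.cons a e : Fin (n + 1) → ℕ) i) : Var 0)) =
      (Fin.cons (Var.free a) (fun i => Var.free (e i)) : Fin (n + 1) → Var 0) := by
  funext i
  exact Fin.cases rfl (fun j => rfl) i

namespace Formula

variable {P : Type u} {R : ℕ → Type v}

/-- The constant `⊤` or `⊥` for a truth value. -/
def const {n : ℕ} : Bool → Formula P R n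
  | true => .top
  | false => .bot

/-- Replace the propositional symbols by their truth values under `v`, rename the free variables
by `ρ` and replace the outer bound variables according to `e`. -/
def translate (v : P → Bool) (ρ : ℕ → ℕ) : {n m : ℕ} → (Fin n → Var m) → Formula P R n →
    Formula P R m
  | _, _, _, .top => .top
  | _, _, _, .bot => .bot
  | _, _, _, .prop p => const (v p)
  | _, _, e, .pred r ts => .pred r (fun i => (ts i).translate ρ e)
  | _, _, e, .neg A => .neg (A.translate v ρ e)
  | _, _, e, .and A B => .and (A.translate v ρ e) (B.translate v ρ e)
  | _, _, e, .or A B => .or (A.translate v ρ e) (B.translate v ρ e)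
  | _, _, e, .imp A B => .imp (A.translate v ρ e) (B.translate v ρ e)
  | _, _, e, .all A => .all (A.translate v ρ (Var.lift e))
  | _, _, e, .ex A => .ex (A.translate v ρ (Var.lift e))

theorem subst_subst {n : ℕ} (A : Formula P R n) : ∀ {m k : ℕ} (e : Fin n → Var m)
    (σ : Fin m → Var k), (A.subst e).subst σ = A.subst (fun i => (e i).subst σ) := by
  induction A with
  | pred r ts =>
    intro m k e σ
    simp only [subst]
    congr 1
    funext i
    cases ts i <;> rfl
  | all A ih => intro m k e σ; simp only [subst, ih, Var.lift_subst_lift]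
  | ex A ih => intro m k e σ; simp only [subst, ih, Var.lift_subst_lift]
  | _ => intros; simp_all only [subst]

theorem translate_subst (v : P → Bool) (ρ : ℕ → ℕ) {n : ℕ} (A : Formula P R n) :
    ∀ {m k : ℕ} (e : Fin n → Var m) (σ : Fin m → Var k),
      (A.translate v ρ e).subst σ = A.translate v ρ (fun i => (e i).subst σ) := by
  induction A with
  | prop p => intro m k e σ; simp only [translate]; cases v p <;> rfl
  | pred r ts =>
    intro m k e σ
    simp only [translate, subst]
    congr 1
    funext i
    cases ts i <;> rfl
  | all A ih => intro m k e σ; simp only [translate, subst, ih, Var.lift_subst_lift]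
  | ex A ih => intro m k e σ; simp only [translate, subst, ih, Var.lift_subst_lift]
  | _ => intros; simp_all only [translate, subst]

theorem subst_translate (v : P → Bool) (ρ : ℕ → ℕ) {n : ℕ} (A : Formula P R n) :
    ∀ {m k : ℕ} (σ : Fin n → Var m) (e : Fin m → Var k),
      (A.subst σ).translate v ρ e = A.translate v ρ (fun i => (σ i).translate ρ e) := by
  induction A with
  | pred r ts =>
    intro m k e σ
    simp only [translate, subst]
    congr 1
    funext i
    cases ts i <;> rfl
  | all A ih => intro m k e σ; simp only [translate, subst, ih, Var.lift_translate_lift]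
  | ex A ih => intro m k e σ; simp only [translate, subst, ih, Var.lift_translate_lift]
  | _ => intros; simp_all only [translate, subst]

theorem translate_congr (v : P → Bool) {ρ ρ' : ℕ → ℕ} {n : ℕ} (A : Formula P R n) :
    ∀ {m : ℕ} (e : Fin n → Var m), (∀ a, A.HasVar a → ρ a = ρ' a) →
      A.translate v ρ e = A.translate v ρ' e := by
  induction A with
  | pred r ts =>
    intro m e h
    simp only [translate]
    congr 1
    funext i
    rcases hi : ts i with a | j
    · simp [Var.translate, h a ⟨i, hi⟩]
    · rfl
  | neg A ih => intro m e h; simp only [translate]; rw [ih e h]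
  | all A ih => intro m e h; simp only [translate]; rw [ih _ h]
  | ex A ih => intro m e h; simp only [translate]; rw [ih _ h]
  | and A B ihA ihB | or A B ihA ihB | imp A B ihA ihB =>
    intro m e h
    simp only [translate]
    rw [ihA e fun a ha => h a (.inl ha), ihB e fun a ha => h a (.inr ha)]
  | _ => intros; rfl

theorem IsPropositional.translate {v : P → Bool} {ρ : ℕ → ℕ} {n : ℕ} {A : Formula P R n}
    (hA : A.IsPropositional) : ∀ {m : ℕ} (e : Fin n → Var m),
      (A.translate v ρ e).IsPropositional := by
  induction A with
  | prop p => intro m e; simp only [Formula.translate]; cases v p <;> trivial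
  | pred r ts => exact hA.elim
  | neg A ih => exact fun e => ih hA e
  | all A ih => exact fun e => ih hA _
  | ex A ih => exact fun e => ih hA _
  | and A B ihA ihB | or A B ihA ihB | imp A B ihA ihB =>
    exact fun e => ⟨ihA hA.1 e, ihB hA.2 e⟩
  | _ => exact fun _ => trivial

/-- The instance at `a` of a translation under one quantifier. -/
theorem translate_lift_inst (v : P → Bool) (ρ : ℕ → ℕ) {n : ℕ} (A : Formula P R (n + 1))
    (e : Fin n → Var 0) (a : ℕ) :
    (A.translate v ρ (Var.lift e)).inst a =
      A.translate v ρ (Fin.cons (Var.free a) e : Fin (n + 1) → Var 0) := by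
  rw [inst, translate_subst, Var.lift_subst_free]

theorem subst_lift_inst {n : ℕ} (A : Formula P R (n + 1)) (e : Fin n → Var 0) (a : ℕ) :
    (A.subst (Var.lift e)).inst a =
      A.subst (Fin.cons (Var.free a) e : Fin (n + 1) → Var 0) := by
  rw [inst, subst_subst, Var.lift_subst_free]

theorem inst_translate (v : P → Bool) (ρ : ℕ → ℕ) (A : Formula P R 1) (e : Fin 0 → Var 0)
    (a : ℕ) : (A.inst a).translate v ρ e = (A.translate v ρ (Var.lift e)).inst (ρ a) := by
  rw [translate_lift_inst, inst, subst_translate]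
  congr 1
  funext i
  rw [Fin.fin_one_eq_zero i]
  rfl

theorem exists_bound_hasVar {n : ℕ} (A : Formula P R n) : ∃ N, ∀ a, A.HasVar a → a < N := by
  induction A with
  | pred r ts =>
    -- Bound variables get the dummy value 0, as only free names have to be bounded; adding 1 makes
    -- the bound strict.
    refine ⟨(Finset.univ.sup fun i => (ts i).value id fun _ => 0) + 1, ?_⟩
    rintro a ⟨i, hi⟩
    have := Finset.le_sup (f := fun i => (ts i).value id fun _ => 0) (Finset.mem_univ i)
    rw [hi] at this
    exact Nat.lt_succ_of_le this
  | neg A ih | all A ih | ex A ih => exact ih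
  | and A B ihA ihB | or A B ihA ihB | imp A B ihA ihB =>
    obtain ⟨M, hM⟩ := ihA
    obtain ⟨N, hN⟩ := ihB
    exact ⟨max M N, fun a h => h.elim (fun h => lt_max_of_lt_left (hM a h))
      fun h => lt_max_of_lt_right (hN a h)⟩
  | _ => exact ⟨0, fun _ h => h.elim⟩

theorem exists_bound_hasVar_list (Γ : List (Formula P R 0)) :
    ∃ N, ∀ G ∈ Γ, ∀ a, G.HasVar a → a < N := by
  induction Γ with
  | nil => exact ⟨0, by simp⟩
  | cons A Γ ih =>
    obtain ⟨M, hM⟩ := A.exists_bound_hasVar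
    obtain ⟨N, hN⟩ := ih
    refine ⟨max M N, fun G hG a h => ?_⟩
    rcases List.mem_cons.1 hG with rfl | hG
    · exact lt_max_of_lt_left (hM a h)
    · exact lt_max_of_lt_right (hN G hG a h)

/-- Some variable occurs neither in `F` nor in `Γ` nor in `Λ`. -/
theorem exists_fresh (F : Formula P R 1) (Γ : List (Formula P R 0))
    (Λ : Option (Formula P R 0)) :
    ∃ a, ¬ F.HasVar a ∧ (∀ G ∈ Γ, ¬ G.HasVar a) ∧ ∀ G ∈ Λ, ¬ G.HasVar a := by
  obtain ⟨M, hM⟩ := F.exists_bound_hasVar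
  obtain ⟨N, hN⟩ := exists_bound_hasVar_list (Γ ++ Λ.toList)
  refine ⟨max M N, fun h => ?_, fun G hG h => ?_, fun G hG h => ?_⟩
  · have := hM _ h; omega
  · have := hN G (by simp [hG]) _ h; omega
  · have := hN G (by simp [Option.mem_def.1 hG]) _ h; omega

/-- Finiteness matters because each symbol to be eliminated costs one application of neutralization.
-/
theorem exists_finset_occ {n : ℕ} (A : Formula P R n) :
    ∃ s : Finset P, ∀ p b, A.Occ p b → p ∈ s := by
  classical
  induction A with
  | prop q => exact ⟨{q}, fun p b h => by simp [h.1]⟩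
  | neg A ih => exact ih.imp fun s hs p b h => hs p _ h
  | all A ih | ex A ih => exact ih
  | and A B ihA ihB | or A B ihA ihB | imp A B ihA ihB =>
    obtain ⟨s, hs⟩ := ihA
    obtain ⟨t, ht⟩ := ihB
    exact ⟨s ∪ t, fun p b h => Finset.mem_union.2 (h.imp (hs p _) (ht p _))⟩
  | _ => exact ⟨∅, fun _ _ h => h.elim⟩

theorem occ_subst (p : P) {n : ℕ} (A : Formula P R n) : ∀ {m : ℕ} (σ : Fin n → Var m) (b : Bool),
    (A.subst σ).Occ p b ↔ A.Occ p b := by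
  induction A with
  | _ => intros; simp_all only [subst, Occ]

theorem isPropositional_subst {n : ℕ} (A : Formula P R n) : ∀ {m : ℕ} (σ : Fin n → Var m),
    (A.subst σ).IsPropositional ↔ A.IsPropositional := by
  induction A with
  | _ => intros; simp_all only [subst, IsPropositional]

end Formula
end LJP
namespace LJP

universe u v

variable {P : Type u} {R : ℕ → Type v}

open Formula

/-! ### Structural rules, and closure of derivability under replacement. -/

namespace LJPlus

variable {Γ Δ : List (Formula P R 0)} {Λ : Option (Formula P R 0)} {A B : Formula P R 0}

theorem perm_append (h : Γ.Perm Δ) : ∀ Θ : List (Formula P R 0),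
    LJPlus (Θ ++ Γ) Λ → LJPlus (Θ ++ Δ) Λ := by
  induction h with
  | nil => exact fun _ h => h
  | cons A _ ih => exact fun Θ h => by simpa using ih (Θ ++ [A]) (by simpa using h)
  | swap A B Γ => exact fun Θ h => exchange h
  | trans _ _ ih₁ ih₂ => exact fun Θ h => ih₂ Θ (ih₁ Θ h)

theorem perm (h : Γ.Perm Δ) (hΓ : LJPlus Γ Λ) : LJPlus Δ Λ :=
  perm_append h [] hΓ

theorem thin_append (h : LJPlus Γ Λ) : ∀ Δ : List (Formula P R 0), LJPlus (Δ ++ Γ) Λ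
  | [] => h
  | _ :: Δ => thin_left (thin_append h Δ)

theorem contract_mem (hA : A ∈ Γ) (h : LJPlus (A :: Γ) Λ) : LJPlus Γ Λ := by
  classical
  have hp := List.perm_cons_erase hA
  exact perm hp.symm (contraction (perm (hp.cons A) h))

theorem contract_append : ∀ Γ : List (Formula P R 0), Γ ⊆ Δ → LJPlus (Γ ++ Δ) Λ → LJPlus Δ Λ
  | [], _, h => h
  | A :: Γ, hs, h =>
    contract_append Γ (fun _ hB => hs (List.mem_cons_of_mem A hB))
      (contract_mem (List.mem_append_right Γ (hs List.mem_cons_self)) h)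

theorem mono (hs : Γ ⊆ Δ) (h : LJPlus Γ Λ) : LJPlus Δ Λ :=
  contract_append Γ hs (perm List.perm_append_comm (thin_append h Δ))

theorem of_mem (hA : A ∈ Γ) : LJPlus Γ (some A) :=
  mono (by simpa using hA) (ax A)

theorem imp_left' (h₁ : LJPlus Γ (some A)) (h₂ : LJPlus (B :: Γ) Λ) :
    LJPlus (.imp A B :: Γ) Λ :=
  mono (by simp) (imp_left h₁ h₂)

/-- Derivable formulas can be dropped from the antecedent. -/
theorem cut_all : ∀ Γ : List (Formula P R 0), (∀ G ∈ Γ, LJPlus [] (some G)) →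
    LJPlus (Γ ++ Δ) Λ → LJPlus Δ Λ
  | [], _, h => h
  | A :: Γ, hΓ, h =>
    cut_all Γ (fun G hG => hΓ G (List.mem_cons_of_mem A hG))
      (cut (Γ := []) (hΓ A List.mem_cons_self) h)

/-- Derivability is preserved when propositional symbols are replaced by truth values and free
variables are renamed. -/
theorem translate (v : P → Bool) (h : LJPlus Γ Λ) : ∀ (ρ : ℕ → ℕ) (e : Fin 0 → Var 0),
    LJPlus (Γ.map (Formula.translate v ρ e)) (Λ.map (Formula.translate v ρ e)) := by
  have hcongr : ∀ (Γ : List (Formula P R 0)) (ρ : ℕ → ℕ) (e : Fin 0 → Var 0) (a b : ℕ),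
      (∀ G ∈ Γ, ¬ G.HasVar a) → Γ.map (Formula.translate v (Function.update ρ a b) e) =
        Γ.map (Formula.translate v ρ e) := by
    intro Γ ρ e a b hΓ
    refine List.map_congr_left fun G hG => translate_congr v G e fun c hc => ?_
    rw [Function.update_of_ne]
    rintro rfl
    exact hΓ G hG hc
  have hcongrF : ∀ (F : Formula P R 1) (ρ : ℕ → ℕ) (e : Fin 1 → Var 1) (a b : ℕ),
      ¬ F.HasVar a → F.translate v (Function.update ρ a b) e = F.translate v ρ e := by
    intro F ρ e a b hF
    refine translate_congr v F e fun c hc => ?_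
    rw [Function.update_of_ne]
    rintro rfl
    exact hF hc
  induction h with
  | ax A => exact fun ρ e => ax _
  | top_ax => exact fun ρ e => top_ax
  | bot_ax => exact fun ρ e => bot_ax
  | thin_left _ ih => exact fun ρ e => thin_left (ih ρ e)
  | thin_right _ ih => exact fun ρ e => thin_right (ih ρ e)
  | contraction _ ih => exact fun ρ e => contraction (ih ρ e)
  | exchange _ ih =>
    intro ρ e
    have := ih ρ e
    simp only [List.map_append, List.map_cons] at this ⊢
    exact exchange this
  | cut _ _ ih₁ ih₂ =>
    intro ρ e
    rw [List.map_append]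
    exact cut (ih₁ ρ e) (ih₂ ρ e)
  | and_right _ _ ih₁ ih₂ => exact fun ρ e => and_right (ih₁ ρ e) (ih₂ ρ e)
  | and_left₁ _ ih => exact fun ρ e => and_left₁ (ih ρ e)
  | and_left₂ _ ih => exact fun ρ e => and_left₂ (ih ρ e)
  | or_left _ _ ih₁ ih₂ => exact fun ρ e => or_left (ih₁ ρ e) (ih₂ ρ e)
  | or_right₁ _ ih => exact fun ρ e => or_right₁ (ih ρ e)
  | or_right₂ _ ih => exact fun ρ e => or_right₂ (ih ρ e)
  | neg_right _ ih => exact fun ρ e => neg_right (ih ρ e)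
  | neg_left _ ih => exact fun ρ e => neg_left (ih ρ e)
  | imp_right _ ih => exact fun ρ e => imp_right (ih ρ e)
  | imp_left _ _ ih₁ ih₂ =>
    intro ρ e
    rw [List.map_cons, List.map_append]
    exact imp_left (ih₁ ρ e) (ih₂ ρ e)
  | @all_right F Γ a hF hΓ _ ih =>
    intro ρ e
    -- Since `ρ` need not be injective, `ρ a` may violate the eigenvariable condition. The induction
    -- hypothesis is therefore used with `a` sent to a variable `b` fresh for the translated
    -- sequent.
    obtain ⟨b, hb, hbΓ, -⟩ := exists_fresh (F.translate v ρ (Var.lift e))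
      (Γ.map (Formula.translate v ρ e)) none
    have := ih (Function.update ρ a b) e
    rw [hcongr Γ ρ e a b hΓ, Option.map_some, inst_translate, hcongrF F ρ _ a b hF,
      Function.update_self] at this
    exact all_right b hb hbΓ this
  | @all_left F Γ Λ a _ ih =>
    intro ρ e
    have := ih ρ e
    rw [List.map_cons, inst_translate] at this
    exact all_left (ρ a) this
  | @ex_right F Γ a _ ih =>
    intro ρ e
    have := ih ρ e
    rw [Option.map_some, inst_translate] at this
    exact ex_right (ρ a) this
  | @ex_left F Γ Λ a hF hΓ hΛ _ ih =>
    intro ρ e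
    obtain ⟨b, hb, hbΓ, hbΛ⟩ := exists_fresh (F.translate v ρ (Var.lift e))
      (Γ.map (Formula.translate v ρ e)) (Λ.map (Formula.translate v ρ e))
    have hΛ' : Λ.map (Formula.translate v (Function.update ρ a b) e) =
        Λ.map (Formula.translate v ρ e) := by
      cases Λ with
      | none => rfl
      | some G => simpa using hcongr [G] ρ e a b (by simpa using hΛ)
    have := ih (Function.update ρ a b) e
    rw [List.map_cons, hcongr Γ ρ e a b hΓ, hΛ', inst_translate, hcongrF F ρ _ a b hF,
      Function.update_self] at this
    exact ex_left b hb hbΓ hbΛ this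
  | neutralization hN _ _ ih₁ ih₂ =>
    exact fun ρ e => neutralization (hN.translate e) (ih₁ ρ e) (ih₂ ρ e)

end LJPlus

/-! ### Kleene's slash relative to a valuation, and its soundness. -/

/-- Kleene's slash for the formula obtained from `A` by replacing the propositional symbols by
their truth values under `v` and evaluating its variables by `ρ` and `e`. -/
def Slash (v : P → Bool) (ρ : ℕ → ℕ) : {n : ℕ} → (Fin n → ℕ) → Formula P R n → Prop
  | _, _, .top => True
  | _, _, .bot => False
  | _, _, .prop p => v p = true
  | _, e, .pred r ts => Derivable ((Formula.pred r ts).translate v ρ fun i => (.free (e i) : Var 0))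
  | _, e, .neg A =>
    Derivable (A.neg.translate v ρ fun i => (.free (e i) : Var 0)) ∧ ¬ Slash v ρ e A
  | _, e, .and A B => Slash v ρ e A ∧ Slash v ρ e B
  | _, e, .or A B => Slash v ρ e A ∨ Slash v ρ e B
  | _, e, .imp A B =>
    Derivable ((A.imp B).translate v ρ fun i => (.free (e i) : Var 0)) ∧
      (Slash v ρ e A → Slash v ρ e B)
  | _, e, .all A =>
    Derivable (A.all.translate v ρ fun i => (.free (e i) : Var 0)) ∧
      ∀ a : ℕ, Slash v ρ (Fin.cons a e) A
  | _, e, .ex A => ∃ a : ℕ, Slash v ρ (Fin.cons a e) A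

namespace Slash

variable {v : P → Bool} {ρ : ℕ → ℕ}

/-- Derivability is built into the clauses for predicate atoms, `¬`, `⊃` and `∀`; for the other
connectives it is rebuilt with the right rules. -/
theorem derivable {n : ℕ} {A : Formula P R n} : ∀ {e : Fin n → ℕ}, Slash v ρ e A →
    Derivable (A.translate v ρ fun i => (.free (e i) : Var 0)) := by
  induction A with
  | top => exact fun _ => LJPlus.top_ax
  | bot => exact fun h => h.elim
  | prop p =>
    intro e h
    simp only [Slash] at h
    simp only [Formula.translate, h]
    exact LJPlus.top_ax
  | pred r ts => exact fun h => h
  | neg A ih => exact fun h => h.1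
  | and A B ihA ihB => exact fun h => LJPlus.and_right (ihA h.1) (ihB h.2)
  | or A B ihA ihB =>
    exact fun h => h.elim (fun h => LJPlus.or_right₁ (ihA h)) fun h => LJPlus.or_right₂ (ihB h)
  | imp A B ihA ihB => exact fun h => h.1
  | all A ih => exact fun h => h.1
  | ex A ih =>
    rintro e ⟨a, h⟩
    refine LJPlus.ex_right a ?_
    rw [translate_lift_inst, ← Var.free_comp_cons]
    exact ih h

theorem value_translate {n m : ℕ} (σ : Fin n → Var m) (e : Fin m → ℕ) :
    (fun i => (.free ((σ i).value ρ e) : Var 0)) =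
      fun i => (σ i).translate ρ fun j => (.free (e j) : Var 0) := by
  funext i
  cases σ i <;> rfl

theorem subst_iff {n : ℕ} (A : Formula P R n) : ∀ {m : ℕ} (σ : Fin n → Var m) (e : Fin m → ℕ),
    Slash v ρ e (A.subst σ) ↔ Slash v ρ (fun i => (σ i).value ρ e) A := by
  have key : ∀ {n m : ℕ} (A : Formula P R n) (σ : Fin n → Var m) (e : Fin m → ℕ),
      (A.subst σ).translate v ρ (fun i => (.free (e i) : Var 0)) =
        A.translate v ρ fun i => (.free ((σ i).value ρ e) : Var 0) := by
    intro n m A σ e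
    rw [subst_translate, value_translate]
  induction A with
  | top | bot | prop p => exact fun _ _ => Iff.rfl
  | pred r ts =>
    intro m σ e
    have := key (.pred r ts) σ e
    simp only [Formula.subst, Slash] at this ⊢
    rw [this]
  | neg A ih =>
    intro m σ e
    have := key A.neg σ e
    simp only [Formula.subst, Slash, ih] at this ⊢
    rw [this]
  | and A B ihA ihB | or A B ihA ihB =>
    intro m σ e
    simp only [Formula.subst, Slash, ihA, ihB]
  | imp A B ihA ihB =>
    intro m σ e
    have := key (A.imp B) σ e
    simp only [Formula.subst, Slash, ihA, ihB] at this ⊢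
    rw [this]
  | all A ih =>
    intro m σ e
    have := key A.all σ e
    simp only [Formula.subst, Slash, ih, Var.lift_value_cons] at this ⊢
    rw [this]
  | ex A ih =>
    intro m σ e
    simp only [Formula.subst, Slash, ih, Var.lift_value_cons]

theorem inst_iff (A : Formula P R 1) (a : ℕ) (e : Fin 0 → ℕ) :
    Slash v ρ e (A.inst a) ↔ Slash v ρ (Fin.cons (ρ a) e : Fin 1 → ℕ) A := by
  rw [inst, subst_iff]
  have : (fun _ : Fin 1 => (Var.free a : Var 0).value ρ e) = (Fin.cons (ρ a) e : Fin 1 → ℕ) := by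
    funext i
    rw [Fin.fin_one_eq_zero i]
    rfl
  rw [this]

/-- This makes the slash of `B` independent of the witness, so it can be moved from one value of `x`
to another. -/
theorem weaken_iff (B : Formula P R 0) (e : Fin 1 → ℕ) (e' : Fin 0 → ℕ) :
    Slash v ρ e B.weaken ↔ Slash v ρ e' B := by
  rw [weaken, subst_iff, Subsingleton.elim (fun i : Fin 0 => _) e']

theorem congr {ρ' : ℕ → ℕ} {n : ℕ} (A : Formula P R n) : ∀ (e : Fin n → ℕ),
    (∀ a, A.HasVar a → ρ a = ρ' a) → (Slash v ρ e A ↔ Slash v ρ' e A) := by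
  induction A with
  | top | bot | prop p => exact fun _ _ => Iff.rfl
  | pred r ts => intro e h; simp only [Slash]; rw [translate_congr v _ _ h]
  | neg A ih => intro e h; simp only [Slash]; rw [translate_congr v _ _ h, ih e h]
  | and A B ihA ihB | or A B ihA ihB =>
    intro e h
    simp only [Slash]
    rw [ihA e fun a ha => h a (.inl ha), ihB e fun a ha => h a (.inr ha)]
  | imp A B ihA ihB =>
    intro e h
    simp only [Slash]
    rw [translate_congr v _ _ h, ihA e fun a ha => h a (.inl ha),
      ihB e fun a ha => h a (.inr ha)]
  | all A ih =>
    intro e h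
    simp only [Slash]
    rw [translate_congr v _ _ h]
    simp only [ih _ h]
  | ex A ih => intro e h; simp only [Slash, ih _ h]

theorem update_iff {n : ℕ} {A : Formula P R n} {e : Fin n → ℕ} {a : ℕ} (hA : ¬ A.HasVar a)
    (b : ℕ) : Slash v (Function.update ρ a b) e A ↔ Slash v ρ e A := by
  refine congr A e fun c hc => Function.update_of_ne ?_ _ _
  rintro rfl
  exact hA hc

/-- Propositional formulas are decided by the valuation. -/
theorem derivable_neg {n : ℕ} {N : Formula P R n} (hN : N.IsPropositional) : ∀ {e : Fin n → ℕ},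
    ¬ Slash v ρ e N → Derivable (N.neg.translate v ρ fun i => (.free (e i) : Var 0)) := by
  induction N with
  | top => exact fun h => (h trivial).elim
  | bot => exact fun _ => LJPlus.neg_right LJPlus.bot_ax
  | prop p =>
    intro e h
    simp only [Slash, Bool.not_eq_true] at h
    simp only [Formula.translate, h]
    exact LJPlus.neg_right LJPlus.bot_ax
  | pred r ts => exact hN.elim
  | neg A ih =>
    intro e h
    by_cases hA : Slash v ρ e A
    · exact LJPlus.neg_right (LJPlus.neg_left hA.derivable)
    · exact (h ⟨ih hN hA, hA⟩).elim
  | and A B ihA ihB =>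
    intro e h
    refine LJPlus.neg_right ?_
    by_cases hA : Slash v ρ e A
    · exact LJPlus.and_left₂
        (LJPlus.cut (ihB hN.2 fun hB => h ⟨hA, hB⟩) (LJPlus.neg_left (LJPlus.ax _)))
    · exact LJPlus.and_left₁ (LJPlus.cut (ihA hN.1 hA) (LJPlus.neg_left (LJPlus.ax _)))
  | or A B ihA ihB =>
    intro e h
    exact LJPlus.neg_right (LJPlus.or_left
      (LJPlus.cut (ihA hN.1 fun hA => h (.inl hA)) (LJPlus.neg_left (LJPlus.ax _)))
      (LJPlus.cut (ihB hN.2 fun hB => h (.inr hB)) (LJPlus.neg_left (LJPlus.ax _))))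
  | imp A B ihA ihB =>
    intro e h
    by_cases hB : Slash v ρ e B
    · exact (h ⟨LJPlus.imp_right (LJPlus.thin_left hB.derivable), fun _ => hB⟩).elim
    by_cases hA : Slash v ρ e A
    · exact LJPlus.neg_right (LJPlus.imp_left' hA.derivable
        (LJPlus.cut (ihB hN.2 hB) (LJPlus.neg_left (LJPlus.ax _))))
    · exact (h ⟨LJPlus.imp_right (LJPlus.thin_right
        (LJPlus.cut (ihA hN.1 hA) (LJPlus.neg_left (LJPlus.ax _)))), fun h => (hA h).elim⟩).elim
  | all A ih =>
    intro e h
    -- If every instance is slashed, a fresh instance yields the universal formula, contradicting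
    -- `h`; otherwise a failing instance refutes it.
    by_cases hA : ∀ a : ℕ, Slash v ρ (Fin.cons a e) A
    · obtain ⟨a, ha, -, -⟩ := exists_fresh
        (A.translate v ρ (Var.lift fun i => (.free (e i) : Var 0))) [] none
      refine (h ⟨LJPlus.all_right a ha (by simp) ?_, hA⟩).elim
      rw [translate_lift_inst, ← Var.free_comp_cons]
      exact (hA a).derivable
    · push Not at hA
      obtain ⟨a, hA⟩ := hA
      refine LJPlus.neg_right (LJPlus.all_left a ?_)
      rw [translate_lift_inst, ← Var.free_comp_cons]
      exact LJPlus.cut (ih hN hA) (LJPlus.neg_left (LJPlus.ax _))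
  | ex A ih =>
    intro e h
    obtain ⟨a, ha, -, -⟩ := exists_fresh
      (A.translate v ρ (Var.lift fun i => (.free (e i) : Var 0))) [] none
    refine LJPlus.neg_right (LJPlus.ex_left a ha (by simp) (by simp) ?_)
    rw [translate_lift_inst, ← Var.free_comp_cons]
    exact LJPlus.cut (ih hN fun hA => h ⟨a, hA⟩) (LJPlus.neg_left (LJPlus.ax _))

end Slash

/-- The slash is sound for LJ⁺. -/
theorem LJPlus.slash (v : P → Bool) {Γ : List (Formula P R 0)} {Λ : Option (Formula P R 0)}
    (h : LJPlus Γ Λ) : ∀ (ρ : ℕ → ℕ) (e : Fin 0 → ℕ), (∀ G ∈ Γ, Slash v ρ e G) →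
      ∃ G ∈ Λ, Slash v ρ e G := by
  -- The clauses for `¬`, `⊃` and `∀` also ask for derivability. It is obtained by translating the
  -- derivation and cutting away the slashed antecedents, whose translations are derivable.
  have hder : ∀ {Γ Δ : List (Formula P R 0)} {Λ : Option (Formula P R 0)} {ρ : ℕ → ℕ}
      {e : Fin 0 → ℕ}, LJPlus (Δ ++ Γ) Λ → (∀ G ∈ Γ, Slash v ρ e G) →
      LJPlus (Δ.map (Formula.translate v ρ fun i => (.free (e i) : Var 0)))
        (Λ.map (Formula.translate v ρ fun i => (.free (e i) : Var 0))) := by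
    intro Γ Δ Λ ρ e h hΓ
    refine cut_all (Γ.map (Formula.translate v ρ fun i => (.free (e i) : Var 0))) ?_ ?_
    · intro G hG
      obtain ⟨G', hG', rfl⟩ := List.mem_map.1 hG
      exact (hΓ G' hG').derivable
    · rw [← List.map_append]
      exact (h.perm List.perm_append_comm).translate v ρ _
  have hupd : ∀ {Γ : List (Formula P R 0)} {ρ : ℕ → ℕ} {e : Fin 0 → ℕ} {a : ℕ} (b : ℕ),
      (∀ G ∈ Γ, ¬ G.HasVar a) → (∀ G ∈ Γ, Slash v ρ e G) →
      ∀ G ∈ Γ, Slash v (Function.update ρ a b) e G :=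
    fun b ha hΓ G hG => (Slash.update_iff (ha G hG) b).2 (hΓ G hG)
  induction h with
  | ax A => intro ρ e hΓ; simpa using hΓ
  | top_ax => intro ρ e hΓ; simp [Slash]
  | bot_ax => intro ρ e hΓ; simp [Slash] at hΓ
  | thin_left _ ih =>
    intro ρ e hΓ
    exact ih ρ e (List.forall_mem_cons.1 hΓ).2
  | thin_right _ ih =>
    intro ρ e hΓ
    simpa using ih ρ e hΓ
  | contraction _ ih =>
    intro ρ e hΓ
    exact ih ρ e (by simpa using hΓ)
  | exchange _ ih =>
    intro ρ e hΓ
    exact ih ρ e fun G hG => hΓ G (by simp at hG ⊢; tauto)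
  | cut _ _ ih₁ ih₂ =>
    intro ρ e hΓ
    rw [List.forall_mem_append] at hΓ
    obtain ⟨C, hC, h⟩ := ih₁ ρ e hΓ.1
    obtain rfl := Option.some.inj hC
    exact ih₂ ρ e (List.forall_mem_cons.2 ⟨h, hΓ.2⟩)
  | and_right _ _ ih₁ ih₂ =>
    intro ρ e hΓ
    have h₁ := ih₁ ρ e hΓ
    have h₂ := ih₂ ρ e hΓ
    simp_all [Slash]
  | and_left₁ _ ih =>
    intro ρ e hΓ
    rw [List.forall_mem_cons] at hΓ
    exact ih ρ e (List.forall_mem_cons.2 ⟨hΓ.1.1, hΓ.2⟩)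
  | and_left₂ _ ih =>
    intro ρ e hΓ
    rw [List.forall_mem_cons] at hΓ
    exact ih ρ e (List.forall_mem_cons.2 ⟨hΓ.1.2, hΓ.2⟩)
  | or_left _ _ ih₁ ih₂ =>
    intro ρ e hΓ
    rw [List.forall_mem_cons] at hΓ
    exact hΓ.1.elim (fun h => ih₁ ρ e (List.forall_mem_cons.2 ⟨h, hΓ.2⟩))
      fun h => ih₂ ρ e (List.forall_mem_cons.2 ⟨h, hΓ.2⟩)
  | or_right₁ _ ih =>
    intro ρ e hΓ
    have := ih ρ e hΓ
    simp_all [Slash]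
  | or_right₂ _ ih =>
    intro ρ e hΓ
    have := ih ρ e hΓ
    simp_all [Slash]
  | @neg_right A Γ h ih =>
    intro ρ e hΓ
    refine ⟨_, rfl, hder (Δ := []) (neg_right h) hΓ, fun hA => ?_⟩
    simpa using ih ρ e (List.forall_mem_cons.2 ⟨hA, hΓ⟩)
  | neg_left _ ih =>
    intro ρ e hΓ
    rw [List.forall_mem_cons] at hΓ
    obtain ⟨A, hA, h⟩ := ih ρ e hΓ.2
    obtain rfl := Option.some.inj hA
    exact (hΓ.1.2 h).elim
  | @imp_right A B Γ h ih =>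
    intro ρ e hΓ
    refine ⟨_, rfl, hder (Δ := []) (imp_right h) hΓ, fun hA => ?_⟩
    simpa using ih ρ e (List.forall_mem_cons.2 ⟨hA, hΓ⟩)
  | imp_left _ _ ih₁ ih₂ =>
    intro ρ e hΓ
    rw [List.forall_mem_cons, List.forall_mem_append] at hΓ
    obtain ⟨A, hA, h⟩ := ih₁ ρ e hΓ.2.1
    obtain rfl := Option.some.inj hA
    exact ih₂ ρ e (List.forall_mem_cons.2 ⟨hΓ.1.2 h, hΓ.2.2⟩)
  | @all_right F Γ a hF ha h ih =>
    intro ρ e hΓ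
    refine ⟨_, rfl, hder (Δ := []) (all_right a hF ha h) hΓ, fun b => ?_⟩
    -- Revaluing the eigenvariable as `b` covers all instances and leaves the slash of `Γ` and `F`
    -- unaffected.
    have := ih (Function.update ρ a b) e (hupd b ha hΓ)
    simpa [Slash.inst_iff, Slash.update_iff hF] using this
  | @all_left F Γ Λ a _ ih =>
    intro ρ e hΓ
    rw [List.forall_mem_cons] at hΓ
    exact ih ρ e (List.forall_mem_cons.2 ⟨(Slash.inst_iff F a e).2 (hΓ.1.2 _), hΓ.2⟩)
  | @ex_right F Γ a _ ih =>
    intro ρ e hΓ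
    have := ih ρ e hΓ
    simp only [Option.mem_some_iff, exists_eq_left', Slash.inst_iff] at this
    exact ⟨_, rfl, _, this⟩
  | @ex_left F Γ Λ a hF ha haΛ _ ih =>
    intro ρ e hΓ
    rw [List.forall_mem_cons] at hΓ
    obtain ⟨⟨b, hb⟩, hΓ⟩ := hΓ
    obtain ⟨G, hG, h⟩ := ih (Function.update ρ a b) e (List.forall_mem_cons.2
      ⟨(Slash.inst_iff F a e).2 ((Slash.update_iff hF b).2 (by simpa using hb)), hupd b ha hΓ⟩)
    exact ⟨G, hG, (Slash.update_iff (haΛ G hG) b).1 h⟩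
  | @neutralization N Γ Λ hN _ _ ih₁ ih₂ =>
    intro ρ e hΓ
    -- One of the two premises always applies: a propositional `N` that is not slashed has a
    -- derivable negation, so `¬N` is slashed.
    by_cases h : Slash v ρ e N
    · exact ih₁ ρ e (List.forall_mem_cons.2 ⟨h, hΓ⟩)
    · exact ih₂ ρ e (List.forall_mem_cons.2 ⟨⟨Slash.derivable_neg hN h, h⟩, hΓ⟩)

/-- If `∃x F(x)` is derivable, then every valuation has a witness. -/
theorem exists_slash_of_derivable_ex {F : Formula P R 1} (h : Derivable (.ex F)) (v : P → Bool) :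
    ∃ a : ℕ, Slash v id (fun _ => a) F := by
  obtain ⟨G, hG, h⟩ := LJPlus.slash v h id Fin.elim0 (by simp)
  obtain rfl := Option.some.inj hG
  obtain ⟨a, h⟩ := h
  refine ⟨a, ?_⟩
  convert h using 1
  funext i
  rw [Fin.fin_one_eq_zero i]
  rfl

end LJP
namespace LJP

universe u v

variable {P : Type u} {R : ℕ → Type v}

open Formula

/-! ### From replaced formulas back to the originals: polarity and literals. -/

/-- The literal on `p` that is true under `v`. -/
def literal (v : P → Bool) (p : P) : Formula P R 0 :=
  if v p then .prop p else .neg (.prop p)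

/-- `Γ` contains the literals that account for replacing the occurrences of propositional symbols
of polarity `s` by larger, and those of the other polarity by smaller truth values. -/
def Supports (v : P → Bool) (Γ : List (Formula P R 0)) {n : ℕ} (A : Formula P R n) (s : Bool) :
    Prop :=
  ∀ p, (A.Occ p s → v p = true → .prop p ∈ Γ) ∧
    (A.Occ p (!s) → v p = false → .neg (.prop p) ∈ Γ)

namespace Supports

variable {v : P → Bool} {Γ : List (Formula P R 0)} {n : ℕ} {A B : Formula P R n} {s : Bool}

theorem neg (h : Supports v Γ A.neg s) : Supports v Γ A (!s) := h

theorem and_left (h : Supports v Γ (A.and B) s) : Supports v Γ A s :=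
  fun p => ⟨fun hp => (h p).1 (.inl hp), fun hp => (h p).2 (.inl hp)⟩

theorem and_right (h : Supports v Γ (A.and B) s) : Supports v Γ B s :=
  fun p => ⟨fun hp => (h p).1 (.inr hp), fun hp => (h p).2 (.inr hp)⟩

theorem imp_left (h : Supports v Γ (A.imp B) s) : Supports v Γ A (!s) :=
  fun p => ⟨fun hp => (h p).1 (.inl hp), fun hp => (h p).2 (.inl hp)⟩

theorem imp_right (h : Supports v Γ (A.imp B) s) : Supports v Γ B s :=
  fun p => ⟨fun hp => (h p).1 (.inr hp), fun hp => (h p).2 (.inr hp)⟩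

end Supports

theorem translate_id_pred (v : P → Bool) {n m k : ℕ} (r : R k) (ts : Fin (k + 1) → Var n)
    (e : Fin n → Var m) :
    (Formula.pred r ts : Formula P R n).translate v id e = (Formula.pred r ts).subst e := by
  simp only [Formula.translate, Formula.subst]
  congr 1

/-- Under suitable literals, replacing propositional symbols by truth values strengthens or weakens
a formula, according to polarity. -/
theorem translate_entails (v : P → Bool) (Γ : List (Formula P R 0)) {n : ℕ} (A : Formula P R n) :
    ∀ e : Fin n → Var 0,
      (Supports v Γ A true → LJPlus (A.translate v id e :: Γ) (some (A.subst e))) ∧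
      (Supports v Γ A false → LJPlus (A.subst e :: Γ) (some (A.translate v id e))) := by
  induction A with
  | top | bot =>
    exact fun e => ⟨fun _ => .of_mem List.mem_cons_self, fun _ => .of_mem List.mem_cons_self⟩
  | prop p =>
    intro e
    constructor
    · intro h
      rcases hv : v p with _ | _
      · simp only [Formula.translate, hv]
        exact .mono (by simp [const]) (LJPlus.thin_right LJPlus.bot_ax)
      · exact .of_mem (List.mem_cons_of_mem _ ((h p).1 ⟨rfl, rfl⟩ hv))
    · intro h
      rcases hv : v p with _ | _
      · simp only [Formula.translate, hv]
        have := (h p).2 ⟨rfl, rfl⟩ hv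
        exact .mono (by simpa [Formula.subst] using this)
          (LJPlus.thin_right (LJPlus.neg_left (LJPlus.ax (Formula.prop p))))
      · simp only [Formula.translate, hv]
        exact .mono (by simp) LJPlus.top_ax
  | pred r ts =>
    intro e
    rw [translate_id_pred]
    exact ⟨fun _ => .of_mem List.mem_cons_self, fun _ => .of_mem List.mem_cons_self⟩
  | neg A ih =>
    exact fun e => ⟨fun h => .neg_right (.perm (.swap _ _ _) (.neg_left ((ih e).2 h.neg))),
      fun h => .neg_right (.perm (.swap _ _ _) (.neg_left ((ih e).1 h.neg)))⟩
  | and A B ihA ihB =>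
    exact fun e => ⟨fun h => .and_right (.and_left₁ ((ihA e).1 h.and_left))
        (.and_left₂ ((ihB e).1 h.and_right)),
      fun h => .and_right (.and_left₁ ((ihA e).2 h.and_left))
        (.and_left₂ ((ihB e).2 h.and_right))⟩
  | or A B ihA ihB =>
    exact fun e => ⟨fun h => .or_left
        -- `∨` and `&` have the same polarity clauses, so the lemmas for `&` apply by unfolding.
        (.or_right₁ ((ihA e).1 (Supports.and_left (A := A) (B := B) h)))
        (.or_right₂ ((ihB e).1 (Supports.and_right (A := A) (B := B) h))),
      fun h => .or_left
        (.or_right₁ ((ihA e).2 (Supports.and_left (A := A) (B := B) h)))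
        (.or_right₂ ((ihB e).2 (Supports.and_right (A := A) (B := B) h)))⟩
  | imp A B ihA ihB =>
    exact fun e => ⟨fun h => .imp_right (.perm (.swap _ _ _) (.imp_left' ((ihA e).2 h.imp_left)
        (.perm (.swap _ _ _) (.thin_left ((ihB e).1 h.imp_right))))),
      fun h => .imp_right (.perm (.swap _ _ _) (.imp_left' ((ihA e).1 h.imp_left)
        (.perm (.swap _ _ _) (.thin_left ((ihB e).2 h.imp_right)))))⟩
  | all A ih =>
    refine fun e => ⟨fun h => ?_, fun h => ?_⟩
    · obtain ⟨a, ha, haΓ, -⟩ := exists_fresh (A.subst (Var.lift e))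
        ((Formula.all A).translate v id e :: Γ) none
      refine .all_right a ha haΓ (.all_left a ?_)
      rw [translate_lift_inst, subst_lift_inst]
      exact (ih _).1 h
    · obtain ⟨a, ha, haΓ, -⟩ := exists_fresh (A.translate v id (Var.lift e))
        ((Formula.all A).subst e :: Γ) none
      refine .all_right a ha haΓ (.all_left a ?_)
      rw [translate_lift_inst, subst_lift_inst]
      exact (ih _).2 h
  | ex A ih =>
    refine fun e => ⟨fun h => ?_, fun h => ?_⟩
    · obtain ⟨a, ha, haΓ, haΛ⟩ := exists_fresh (A.translate v id (Var.lift e)) Γ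
        (some ((Formula.ex A).subst e))
      refine .ex_left a ha haΓ haΛ (.ex_right a ?_)
      rw [translate_lift_inst, subst_lift_inst]
      exact (ih _).1 h
    · obtain ⟨a, ha, haΓ, haΛ⟩ := exists_fresh (A.subst (Var.lift e)) Γ
        (some ((Formula.ex A).translate v id e))
      refine .ex_left a ha haΓ haΛ (.ex_right a ?_)
      rw [translate_lift_inst, subst_lift_inst]
      exact (ih _).2 h

/-- A sequent is derivable if it is derivable from the literals of each valuation of finitely many
propositional symbols. -/
theorem LJPlus.of_literals {l : List P} (hl : l.Nodup) : ∀ {Γ : List (Formula P R 0)}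
    {Λ : Option (Formula P R 0)}, (∀ v : P → Bool, LJPlus (l.map (literal v) ++ Γ) Λ) →
      LJPlus Γ Λ := by
  classical
  induction l with
  | nil => exact fun h => h fun _ => true
  | cons p l ih =>
    intro Γ Λ h
    rw [List.nodup_cons] at hl
    have hmap : ∀ (v : P → Bool) (b : Bool),
        l.map (literal (R := R) (Function.update v p b)) = l.map (literal v) := by
      intro v b
      refine List.map_congr_left fun q hq => ?_
      have : q ≠ p := by rintro rfl; exact hl.1 hq
      simp [literal, Function.update_of_ne this]
    -- With the literal on `p` fixed, the other symbols are eliminated by induction; as `p` is not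
    -- in `l`, resetting its value leaves their literals unchanged.
    have key : ∀ b : Bool, LJPlus (literal (fun _ => b) p :: Γ) Λ := by
      refine fun b => ih hl.2 fun v => ?_
      have := h (Function.update v p b)
      rw [List.map_cons, hmap] at this
      have hp : literal (R := R) (Function.update v p b) p = literal (fun _ => b) p := by
        simp [literal]
      rw [hp] at this
      exact perm List.perm_middle.symm this
    exact neutralization (N := .prop p) trivial (by simpa [literal] using key true)
      (by simpa [literal] using key false)

/-- To derive an instance of `A` it suffices to derive, for every valuation `v`, the result of
replacing propositional symbols according to some valuation that makes `A` at least as strong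
as `v` does. -/
theorem derivable_subst_of_forall {n : ℕ} (A : Formula P R n) (e : Fin n → Var 0)
    (h : ∀ v : P → Bool, ∃ w : P → Bool, Derivable (A.translate w id e) ∧
      ∀ p, (A.Occ p true → w p = true → v p = true) ∧
        (A.Occ p false → w p = false → v p = false)) :
    Derivable (A.subst e) := by
  obtain ⟨s, hs⟩ := A.exists_finset_occ
  refine LJPlus.of_literals s.nodup_toList fun v => ?_
  obtain ⟨w, hw, hvw⟩ := h v
  refine LJPlus.cut (Γ := []) hw ((translate_entails w _ A e).1 fun p => ⟨fun hp hwp => ?_,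
    fun hp hwp => ?_⟩)
  all_goals
    refine List.mem_append_left _ (List.mem_map.2 ⟨p, Finset.mem_toList.2 (hs p _ hp), ?_⟩)
  · simp [literal, (hvw p).1 hp hwp]
  · simp [literal, (hvw p).2 hp hwp]

/-! ### Strongest valuations and the three cases. -/

/-- The valuation that agrees with `v` except that on the symbols of `A` it makes the positively
occurring ones false and the others true. -/
noncomputable def strongest {n : ℕ} (A : Formula P R n) (v : P → Bool) (p : P) : Bool :=
  open Classical in
  if A.Occ p true then false else if A.Occ p false then true else v p

theorem strongest_of_occ_true {n : ℕ} {A : Formula P R n} {p : P} (h : A.Occ p true)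
    (v : P → Bool) : strongest A v p = false := by
  simp [strongest, h]

theorem strongest_of_occ_false {n : ℕ} {A : Formula P R n} (hA : A.Unipolar) {p : P}
    (h : A.Occ p false) (v : P → Bool) : strongest A v p = true := by
  have : ¬ A.Occ p true := (hA p).resolve_left (not_not.2 h)
  simp [strongest, h, this]

theorem strongest_of_not_contains {n : ℕ} {A : Formula P R n} {p : P} (h : ¬ A.Contains p)
    (v : P → Bool) : strongest A v p = v p := by
  rw [Contains, not_or] at h
  simp [strongest, h.1, h.2]

/-- For a unipolar formula it suffices to consider one strongest valuation. -/
theorem derivable_inst_of_strongest {A : Formula P R 1} (hA : A.Unipolar) {v : P → Bool} {a : ℕ}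
    (h : Slash (strongest A v) id (fun _ => a) A) : Derivable (A.inst a) := by
  -- The comparison with `w` is vacuous: positive symbols are never true and negative ones never
  -- false under `strongest A v`.
  refine derivable_subst_of_forall A _ fun w => ⟨strongest A v, h.derivable, fun p => ⟨?_, ?_⟩⟩
  · intro hp h
    simp [strongest_of_occ_true hp] at h
  · intro hp h
    simp [strongest_of_occ_false hA hp] at h

/-- If every symbol of `A` in `C` has in `C` only the polarity it has in `A`, then strongest
valuations for `A` suffice for `C`. -/
theorem derivable_inst_of_forall_strongest {A C : Formula P R 1} (hA : A.Unipolar)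
    (hAC : ∀ p b, C.Occ p b → A.Contains p → A.Occ p b) (a : ℕ)
    (h : ∀ v : P → Bool, Slash (strongest A v) id (fun _ => a) C) : Derivable (C.inst a) := by
  refine derivable_subst_of_forall C _ fun v => ⟨strongest A v, (h v).derivable,
    fun p => ⟨?_, ?_⟩⟩
  · intro hp h
    -- Symbols of `A` make the condition vacuous; on all others the valuation agrees with `v`.
    by_cases hpA : A.Contains p
    · simp [strongest_of_occ_true (hAC p _ hp hpA)] at h
    · rwa [strongest_of_not_contains hpA] at h
  · intro hp h
    by_cases hpA : A.Contains p
    · simp [strongest_of_occ_false hA (hAC p _ hp hpA)] at h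
    · rwa [strongest_of_not_contains hpA] at h

/-- The witness comes from one strongest valuation for `A`. Every valuation slashes `B`, possibly at
another witness, and this suffices to derive `B` since `x` does not occur in it. -/
theorem existenceProperty_and {A : Formula P R 1} (hA : A.Unipolar) (B : Formula P R 0) :
    ExistenceProperty (.and A B.weaken) := by
  intro h
  -- The base valuation is arbitrary: only its values off the symbols of `A` survive, and they do
  -- not affect `A`.
  obtain ⟨a, ha⟩ := exists_slash_of_derivable_ex h (strongest A fun _ => true)
  refine ⟨a, LJPlus.and_right (derivable_inst_of_strongest hA ha.1) ?_⟩
  refine derivable_subst_of_forall B.weaken _ fun v =>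
    ⟨v, ?_, fun p => ⟨fun _ h => h, fun _ h => h⟩⟩
  obtain ⟨b, hb⟩ := exists_slash_of_derivable_ex h v
  have hb := (Slash.weaken_iff B _ Fin.elim0).1 hb.2
  exact ((Slash.weaken_iff B (fun _ => a) Fin.elim0).2 hb).derivable

/-- Either all strongest valuations slash `B`, and then `B` itself is derivable by the polarity
condition, or one of them fails to, and its witness must slash `A`. -/
theorem existenceProperty_or {A : Formula P R 1} (hA : A.Unipolar) {B : Formula P R 0}
    (hAB : ∀ p : P, A.Contains p → B.Contains p → (Formula.or A B.weaken).UnipolarAt p) :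
    ExistenceProperty (.or A B.weaken) := by
  intro h
  by_cases hB : ∀ v : P → Bool, Slash (strongest A v) id (fun _ => 0) B.weaken
  · refine ⟨0, LJPlus.or_right₂ (derivable_inst_of_forall_strongest hA ?_ 0 hB)⟩
    intro p b hp hpA
    have hpB : B.Occ p b := (occ_subst p B _ b).1 hp
    have hu := hAB p hpA (by cases b <;> simp [Contains, hpB])
    simp only [UnipolarAt, Occ, not_or] at hu
    cases b <;> simp only [Contains] at hpA <;> tauto
  · push Not at hB
    obtain ⟨v, hB⟩ := hB
    obtain ⟨a, ha⟩ := exists_slash_of_derivable_ex h (strongest A v)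
    refine ⟨a, LJPlus.or_right₁ (derivable_inst_of_strongest hA (ha.resolve_right fun ha => hB ?_))⟩
    exact (Slash.weaken_iff B _ Fin.elim0).2 ((Slash.weaken_iff B _ Fin.elim0).1 ha)

/-- If some strongest valuation slashes `B`, its witness slashes `A`. Otherwise all of them refute
`B`, which is propositional and hence decided, and `¬B` is derivable. -/
theorem existenceProperty_imp {A : Formula P R 1} (hA : A.Unipolar) {B : Formula P R 0}
    (hB : B.IsPropositional)
    (hAB : ∀ p : P, A.Contains p → B.Contains p → (Formula.imp B.weaken A).UnipolarAt p) :
    ExistenceProperty (.imp B.weaken A) := by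
  intro h
  by_cases hv : ∃ v : P → Bool, Slash (strongest A v) id Fin.elim0 B
  · obtain ⟨v, hv⟩ := hv
    obtain ⟨a, ha⟩ := exists_slash_of_derivable_ex h (strongest A v)
    have hA' := derivable_inst_of_strongest hA (ha.2 ((Slash.weaken_iff B _ _).2 hv))
    exact ⟨a, LJPlus.imp_right (LJPlus.thin_left hA')⟩
  · push Not at hv
    have hneg : Derivable (B.weaken.neg.inst 0) := by
      refine derivable_inst_of_forall_strongest hA ?_ 0 fun v => ?_
      -- A symbol has the same polarity in `¬B` as in the left-hand side of `B ⊃ A`, so unipolarity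
      -- of the implication at shared symbols is what is needed.
      · intro p b hp hpA
        have hpB : B.Occ p !b := (occ_subst p B _ _).1 hp
        have hpB' : B.weaken.Occ p !b := hp
        have hu := hAB p hpA (by cases b <;> simp_all [Contains])
        simp only [UnipolarAt, Occ, not_or] at hu
        cases b <;> simp only [Contains, Bool.not_true, Bool.not_false] at * <;> tauto
      · have hB' : ¬ Slash (strongest A v) id (fun _ => 0) B.weaken :=
          fun h => hv v ((Slash.weaken_iff B _ _).1 h)
        exact ⟨Slash.derivable_neg ((isPropositional_subst B _).2 hB) hB', hB'⟩
    exact ⟨0, LJPlus.imp_right (LJPlus.thin_right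
      (LJPlus.cut (Γ := []) hneg (LJPlus.neg_left (LJPlus.ax _))))⟩

end LJP

theorem mainTheorem5 {P : Type*} {R : ℕ → Type*}
    (A : LJP.Formula P R 1) (hA : A.Unipolar) (B : LJP.Formula P R 0) :
    LJP.ExistenceProperty (.and A B.weaken) ∧
    ((∀ p : P, A.Contains p → B.Contains p → (LJP.Formula.or A B.weaken).UnipolarAt p) →
      LJP.ExistenceProperty (.or A B.weaken)) ∧
    (B.IsPropositional →
      (∀ p : P, A.Contains p → B.Contains p → (LJP.Formula.imp B.weaken A).UnipolarAt p) →
      LJP.ExistenceProperty (.imp B.weaken A)) := by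
  exact ⟨LJP.existenceProperty_and hA B, LJP.existenceProperty_or hA, LJP.existenceProperty_imp hA⟩
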